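/- Let $K$ be a commutative ring with invertible elements $v$ and $s$ such that $z=s-s^{-1}$ is invertible in $K$, and let $n\ge 1$. Let $H_n=R_n^n(v,s)$ be the Homfly skein of the rectangle with $n$ inputs at the bottom and $n$ outputs at the top: the $K$-algebra of $K$-linear combinations of oriented $n$-tangle diagrams, multiplied by stacking, modulo isotopy of diagrams, the second and third Reidemeister moves, and the local framed Homfly relations $X_+-X_-=z\,X_0$ (where $X_+$, $X_-$, $X_0$ are a positive crossing, a negative crossing and the two parallel strings) and (a string with a positive kink) $=v^{-1}\cdot$(the string), for kinks on either side. This is the skein model of the Hecke algebra of type $A$, with generators the elementary positive braids $\sigma_i$, $1\le i<n$, which satisfy the braid relations and $\sigma_i^2=z\sigma_i+1$. For $1\le i<j\le n$ let $\omega_{(i\,j)}=\sigma_i\sigma_{i+1}\cdots\sigma_{j-2}\,\sigma_{j-1}\,\sigma_{j-2}\cdots\sigma_{i+1}\sigma_i$ be the positive permutation braid of the transposition $(i\,j)$. The Murphy operators are $M(j)=\sum_{i=1}^{j-1}\omega_{(i\,j)}\in H_n$ for $2\le j\le n$, and $M=\sum_{j=2}^n M(j)$ is their sum. Let $T^{(n)}\in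 H_n$ be the element represented by a single $n$-tangle, the identity braid on $n$ strings encircled by one counterclockwise loop which passes over all strings in its lower part and under all strings in its upper part (so that it has linking number $1$ with each string). Then $M$ is represented by $T^{(n)}$ up to linear combination with the identity: in $H_n$, $$T^{(n)}=z^2v^{-1}M+\Bigl(nzv^{-1}+\frac{v^{-1}-v}{z}\Bigr)\cdot 1,\qquad\text{that is,}\qquad M=z^{-2}v\,\Bigl(T^{(n)}-\Bigl(nzv^{-1}+\frac{v^{-1}-v}{z}\Bigr)\cdot 1\Bigr).$$ Moreover $T^{(n)}$ is central in $H_n$, and hence so is $M$. -/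

import Mathlib

namespace Homfly

/-! ### Oriented tangle diagrams

A tangle diagram is drawn in a rectangle, in general position with respect to the height, and is cut
by horizontal lines into slices. Each slice holds one crossing, one local minimum (cup) or one local
maximum (cap), with vertical strings to its left and to its right. A horizontal line meets the
diagram in a word of upward and downward strings, read from left to right. -/

/-- The direction of a string where it meets a horizontal line. -/
inductive Dir
  | up
  | down
  deriving DecidableEq

/-- The opposite direction. -/
def Dir.rev : Dir → Dir
  | Dir.up => Dir.down
  | Dir.down => Dir.up

/-- The contents of a slice. In `cross a b o` the string at the bottom left, of direction `a`, goes to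
the top right, and the string at the bottom right, of direction `b`, goes to the top left; the first
of them is the overcrossing string if `o = true`, and the second one if `o = false`. So
`cross up up true` is the positive (right-handed) crossing of two upward strings, and
`cross up up false` is the negative one. In `cup a` and `cap a` the left leg has direction `a`, and
the right leg has the opposite direction. -/
inductive Piece
  | cross (a b : Dir) (o : Bool)
  | cup (a : Dir)
  | cap (a : Dir)

/-- The word at the bottom of a piece. -/
def Piece.dom : Piece → List Dir
  | Piece.cross a b _ => [a, b]
  | Piece.cup _ => []
  | Piece.cap a => [a, a.rev]

/-- The word at the top of a piece. -/
def Piece.cod : Piece → List Dir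
  | Piece.cross a b _ => [b, a]
  | Piece.cup a => [a, a.rev]
  | Piece.cap _ => []

/-- A piece with vertical strings to its left and to its right. -/
structure Slice where
  left : List Dir
  piece : Piece
  right : List Dir

/-- The word at the bottom of a slice. -/
def Slice.dom (S : Slice) : List Dir := S.left ++ S.piece.dom ++ S.right

/-- The word at the top of a slice. -/
def Slice.cod (S : Slice) : List Dir := S.left ++ S.piece.cod ++ S.right

/-- Add vertical strings `u` on the left and `w` on the right of a slice. -/
def Slice.widen (u w : List Dir) (S : Slice) : Slice := ⟨u ++ S.left, S.piece, S.right ++ w⟩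

/-- The slices `L`, listed from bottom to top, fit together to a diagram with bottom word `a` and top
word `b`. -/
def IsDiagram : List Dir → List Slice → List Dir → Prop
  | a, [], b => a = b
  | a, S :: L, b => a = S.dom ∧ IsDiagram S.cod L b

theorem IsDiagram.append {a b c : List Dir} {L L' : List Slice} (h : IsDiagram a L b)
    (h' : IsDiagram b L' c) : IsDiagram a (L ++ L') c := by
  induction L generalizing a with
  | nil => cases h; exact h'
  | cons S L ih => exact ⟨h.1, ih h.2⟩

theorem IsDiagram.of_forall {a : List Dir} {L : List Slice}
    (h : ∀ S ∈ L, a = S.dom ∧ S.cod = a) : IsDiagram a L a := by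
  induction L with
  | nil => rfl
  | cons S L ih =>
    have hS := h S (by simp)
    refine ⟨hS.1, ?_⟩
    rw [hS.2]
    exact ih fun S' hS' => h S' (by simp [hS'])

/-- `n` upward strings. -/
def ups (n : ℕ) : List Dir := List.replicate n Dir.up

/-- Diagrams of `n`-tangles: `n` inputs at the bottom and `n` outputs at the top. -/
@[ext] structure NTangle (n : ℕ) where
  slices : List Slice
  isDiagram : IsDiagram (ups n) slices (ups n)

/-- `n`-tangles are composed by stacking: `D * E` is `D` with `E` on top of it. The unit is the
identity braid. -/
instance (n : ℕ) : Monoid (NTangle n) where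
  mul D E := ⟨D.slices ++ E.slices, D.isDiagram.append E.isDiagram⟩
  one := ⟨[], rfl⟩
  mul_assoc D E F := NTangle.ext (List.append_assoc D.slices E.slices F.slices)
  one_mul _ := rfl
  mul_one D := NTangle.ext (List.append_nil D.slices)

/-! ### The Homfly skein of the rectangle -/

/-- The moves between diagrams, as replacements of one stack of slices by another: the moves
`interchange`, `zigzag`, `capSlide` and `cupSlide` generate isotopy of diagrams in the plane, and
`reidemeister2` and `reidemeister3` are the second and third Reidemeister moves. -/
inductive Move : List Slice → List Slice → Prop
  /-- Two pieces side by side may change their heights. -/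
  | interchange (e f : Piece) (m : List Dir) :
      Move [⟨[], e, m ++ f.dom⟩, ⟨e.cod ++ m, f, []⟩] [⟨e.dom ++ m, f, []⟩, ⟨[], e, m ++ f.cod⟩]
  /-- A minimum followed by a maximum to its right may be straightened. -/
  | zigzag_right (a : Dir) : Move [⟨[], .cup a, [a]⟩, ⟨[a], .cap a.rev, []⟩] []
  /-- A minimum followed by a maximum to its left may be straightened. -/
  | zigzag_left (a : Dir) : Move [⟨[a], .cup a.rev, []⟩, ⟨[], .cap a, [a]⟩] []
  /-- A crossing of a string `b` with one leg of a maximum may be moved to the other leg. -/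
  | capSlide (a b : Dir) (o : Bool) :
      Move [⟨[a], .cross b a.rev o, []⟩, ⟨[], .cap a, [b]⟩]
        [⟨[], .cross a b (!o), [a.rev]⟩, ⟨[b], .cap a, []⟩]
  /-- A crossing of a string `b` with one leg of a minimum may be moved to the other leg. -/
  | cupSlide (a b : Dir) (o : Bool) :
      Move [⟨[b], .cup a, []⟩, ⟨[], .cross b a o, [a.rev]⟩]
        [⟨[], .cup a, [b]⟩, ⟨[a], .cross a.rev b (!o), []⟩]
  | reidemeister2 (a b : Dir) (o : Bool) :
      Move [⟨[], .cross a b o, []⟩, ⟨[], .cross b a (!o), []⟩] []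
  /-- The flags `o₁`, `o₂`, `o₃` say whether `a` is over `b`, `a` is over `c`, and `b` is over `c`;
  the hypothesis says that this is not cyclic. -/
  | reidemeister3 (a b c : Dir) (o₁ o₂ o₃ : Bool) (h : o₁ = o₃ → o₂ = o₁) :
      Move [⟨[], .cross a b o₁, [c]⟩, ⟨[b], .cross a c o₂, []⟩, ⟨[], .cross b c o₃, [a]⟩]
        [⟨[a], .cross b c o₃, []⟩, ⟨[], .cross a c o₂, [b]⟩, ⟨[c], .cross a b o₁, []⟩]

/-- The positive crossing of two upward strings. -/
def posCrossing : List Slice := [⟨[], .cross .up .up true, []⟩]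

/-- The negative crossing of two upward strings. -/
def negCrossing : List Slice := [⟨[], .cross .up .up false, []⟩]

/-- An upward string with a positive kink on its right. -/
def rightKink : List Slice :=
  [⟨[.up], .cup .up, []⟩, ⟨[], .cross .up .up true, [.down]⟩, ⟨[.up], .cap .up, []⟩]

/-- An upward string with a positive kink on its left. -/
def leftKink : List Slice :=
  [⟨[], .cup .down, [.up]⟩, ⟨[.down], .cross .up .up true, []⟩, ⟨[], .cap .down, [.up]⟩]

/-- The diagram `D` contains the local picture `L`: there are slices `p` below and `q` above it, and
vertical strings `u` to its left and `w` to its right. -/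
def NTangle.Has {n : ℕ} (D : NTangle n) (p q : List Slice) (u w : List Dir) (L : List Slice) : Prop :=
  D.slices = p ++ L.map (Slice.widen u w) ++ q

section Skein

variable {K : Type*} [CommRing K] (v s : Kˣ) (n : ℕ)

/-- The relations between linear combinations of `n`-tangle diagrams: the moves, and the two framed
Homfly relations. In each of them the diagrams are equal outside of the local pictures shown. -/
inductive SkeinRel : MonoidAlgebra K (NTangle n) → MonoidAlgebra K (NTangle n) → Prop
  | move (p q : List Slice) (u w : List Dir) (L L' : List Slice) (hL : Move L L')
      (D D' : NTangle n) (hD : D.Has p q u w L) (hD' : D'.Has p q u w L') :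
      SkeinRel (MonoidAlgebra.of K _ D) (MonoidAlgebra.of K _ D')
  | crossing (p q : List Slice) (u w : List Dir) (X Y I : NTangle n)
      (hX : X.Has p q u w posCrossing) (hY : Y.Has p q u w negCrossing) (hI : I.Has p q u w []) :
      SkeinRel (MonoidAlgebra.of K _ X - MonoidAlgebra.of K _ Y)
        (((s : K) - ↑s⁻¹) • MonoidAlgebra.of K _ I)
  | rightKink (p q : List Slice) (u w : List Dir) (C I : NTangle n)
      (hC : C.Has p q u w rightKink) (hI : I.Has p q u w []) :
      SkeinRel (MonoidAlgebra.of K _ C) ((↑v⁻¹ : K) • MonoidAlgebra.of K _ I)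
  | leftKink (p q : List Slice) (u w : List Dir) (C I : NTangle n)
      (hC : C.Has p q u w leftKink) (hI : I.Has p q u w []) :
      SkeinRel (MonoidAlgebra.of K _ C) ((↑v⁻¹ : K) • MonoidAlgebra.of K _ I)

/-- The Homfly skein `R_n^n(v, s)` of `n`-tangles, which is the skein model of the Hecke algebra `H_n`,
with coefficients in `K`. -/
abbrev Skein : Type _ := RingQuot (SkeinRel v s n)

variable {n}

/-- The element of the skein that a diagram represents. -/
noncomputable def cls (D : NTangle n) : Skein v s n :=
  RingQuot.mkAlgHom K (SkeinRel v s n) (MonoidAlgebra.of K _ D)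

end Skein

/-! ### The Murphy operators and the encircled identity braid -/

/-- The slice with the positive crossing of the strings `i` and `i + 1` among `n` upward strings,
counted from `1`. -/
def sigmaSlice (n i : ℕ) : Slice := ⟨ups (i - 1), .cross .up .up true, ups (n - 1 - i)⟩

theorem sigmaSlice_dom {n i : ℕ} (h : 1 ≤ i ∧ i < n) : (sigmaSlice n i).dom = ups n := by
  have hn : n = (i - 1) + 2 + (n - 1 - i) := by omega
  have h2 : [Dir.up, Dir.up] = List.replicate 2 Dir.up := rfl
  conv_rhs => rw [hn]
  simp only [Slice.dom, sigmaSlice, Piece.dom, ups, h2, List.replicate_append_replicate]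

theorem sigmaSlice_cod {n i : ℕ} (h : 1 ≤ i ∧ i < n) : (sigmaSlice n i).cod = ups n :=
  sigmaSlice_dom h

/-- The elementary braid `σ_i` on `n` strings, for `1 ≤ i < n` (and the identity braid for any other
`i`). -/
def sigma (n i : ℕ) : NTangle n :=
  if h : 1 ≤ i ∧ i < n then ⟨[sigmaSlice n i], (sigmaSlice_dom h).symm, sigmaSlice_cod h⟩ else 1

/-- The positive permutation braid `ω_{(i j)}` of the transposition `(i j)`, for `1 ≤ i < j ≤ n`: the
braid `σ_i σ_{i+1} ⋯ σ_{j-2} σ_{j-1} σ_{j-2} ⋯ σ_{i+1} σ_i`, whose word is reduced. -/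
def omega (n i j : ℕ) : NTangle n :=
  ((List.range' i (j - i)).map (sigma n)).prod *
    ((List.range' i (j - 1 - i)).reverse.map (sigma n)).prod

/-- The slices of the loop around `n` strings. The loop starts with a minimum to the left of all
strings. Its right leg goes up and passes to the right over all strings, and then to the left under
all strings. The loop is closed by a maximum to the left of all strings. -/
def loopSlices (n : ℕ) : List Slice :=
  [⟨[], .cup .down, ups n⟩] ++
    (List.range' 1 n).map (fun i => (sigmaSlice (n + 1) i).widen [.down] []) ++
    (List.range' 1 n).reverse.map (fun i => (sigmaSlice (n + 1) i).widen [.down] []) ++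
    [⟨[], .cap .down, ups n⟩]

theorem loopSlices_isDiagram (n : ℕ) : IsDiagram (ups n) (loopSlices n) (ups n) := by
  have key : ∀ i ∈ List.range' 1 n,
      Dir.down :: ups (n + 1) = ((sigmaSlice (n + 1) i).widen [.down] []).dom ∧
        ((sigmaSlice (n + 1) i).widen [.down] []).cod = Dir.down :: ups (n + 1) := by
    intro i hi
    have hi' : 1 ≤ i ∧ i < n + 1 := by
      rw [List.mem_range'_1] at hi
      omega
    constructor
    · rw [← sigmaSlice_dom hi']
      simp [Slice.widen, Slice.dom]
    · rw [← sigmaSlice_cod hi']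
      simp [Slice.widen, Slice.cod]
  refine IsDiagram.append (b := Dir.down :: ups (n + 1)) (IsDiagram.append
    (b := Dir.down :: ups (n + 1)) (IsDiagram.append (b := Dir.down :: ups (n + 1)) ?_ ?_) ?_) ?_
  · exact ⟨rfl, rfl⟩
  · exact IsDiagram.of_forall (List.forall_mem_map.2 key)
  · exact IsDiagram.of_forall (List.forall_mem_map.2 fun i hi => key i (List.mem_reverse.1 hi))
  · exact ⟨rfl, rfl⟩

/-- The `n`-tangle `T^{(n)}`: the identity braid on `n` strings, encircled by one loop, which has
linking number `1` with each string. -/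
def encircled (n : ℕ) : NTangle n := ⟨loopSlices n, loopSlices_isDiagram n⟩

section Murphy

variable {K : Type*} [CommRing K] (v s : Kˣ) (n : ℕ)

/-- The Murphy operator `M(j)`, for `2 ≤ j ≤ n`. -/
noncomputable def murphy (j : ℕ) : Skein v s n := ∑ i ∈ Finset.Ico 1 j, cls v s (omega n i j)

/-- The sum `M` of the Murphy operators. -/
noncomputable def murphySum : Skein v s n := ∑ j ∈ Finset.Icc 2 n, murphy v s n j

end Murphy

end Homfly

/-! The loop around `n` strings is the closure of the first of `n + 1` strings in the braid `σ_1 ⋯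
σ_n σ_n ⋯ σ_1`. Resolving the innermost square by `σ² = 1 + zσ`, again and again, turns this braid
into `1 + z ∑ (σ_1 ⋯ σ_{m+1} ⋯ σ_1)`, a sum over `m < n` (`sem_range_append_reverse`). The braid
relations turn each such hill into the valley `σ_{m+1} ⋯ σ_1 ⋯ σ_{m+1}` (`prod_hill`), where the
first string takes part in a single crossing. Closing that string makes the crossing a positive
kink, so a factor `v⁻¹` comes out and `σ_m ⋯ σ_1 σ_1 ⋯ σ_m` remains on `n` strings
(`closure_valley`). A second expansion gives `1 + z M(m+1)`, where the empty sum `M(1)` is zero. The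
identity braid closes to a circle, of value `(v⁻¹ - v) z⁻¹` (`sem_circle`). Adding up gives the
formula (`sem_loop`).

The value of the circle is not one of the relations. It follows from resolving the crossing of a
left kink, once a negative left kink is known to be worth `v`; and this holds since it cancels a
positive right kink without the first Reidemeister move (`rightKink_leftNegKink`).

The loop is central because any slice can be pulled through it, below the arc that passes over and
above the arc that passes under (`loop_slide`).

Skein relations are local, so they are stated for the function `sem`, which sends every place where
a diagram fits to the resulting skein element. Such functions form a `K`-module, and insertion into
a larger diagram is a linear map on it. -/

namespace Homfly

attribute [simp] Slice.dom Slice.cod Slice.widen IsDiagram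

/-! ### Words, slices and places in a diagram -/

section Words

@[simp] theorem Piece.dom_cross (a b : Dir) (o : Bool) : (Piece.cross a b o).dom = [a, b] := rfl
@[simp] theorem Piece.dom_cup (a : Dir) : (Piece.cup a).dom = [] := rfl
@[simp] theorem Piece.dom_cap (a : Dir) : (Piece.cap a).dom = [a, a.rev] := rfl
@[simp] theorem Piece.cod_cross (a b : Dir) (o : Bool) : (Piece.cross a b o).cod = [b, a] := rfl
@[simp] theorem Piece.cod_cup (a : Dir) : (Piece.cup a).cod = [a, a.rev] := rfl
@[simp] theorem Piece.cod_cap (a : Dir) : (Piece.cap a).cod = [] := rfl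
@[simp] theorem Dir.rev_up : Dir.up.rev = Dir.down := rfl
@[simp] theorem Dir.rev_down : Dir.down.rev = Dir.up := rfl

@[simp] theorem widen_nil (S : Slice) : S.widen [] [] = S := by
  cases S; simp

@[simp] theorem widen_nil_eq_id : Slice.widen [] [] = id := funext widen_nil

@[simp] theorem widen_comp_widen (u w u' w' : List Dir) :
    Slice.widen u' w' ∘ Slice.widen u w = Slice.widen (u' ++ u) (w ++ w') := by
  funext S
  simp

theorem IsDiagram.widen {a b : List Dir} {L : List Slice} (h : IsDiagram a L b) (u w : List Dir) :
    IsDiagram (u ++ a ++ w) (L.map (Slice.widen u w)) (u ++ b ++ w) := by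
  induction L generalizing a with
  | nil => cases h; rfl
  | cons S L ih =>
    obtain ⟨rfl, h⟩ := h
    refine ⟨by simp, ?_⟩
    have := ih h
    simpa using this

/-- A place in a tangle diagram where a diagram from the word `a` to the word `b` fits in. -/
structure Ctx (a b : List Dir) where
  n : ℕ
  below : List Slice
  above : List Slice
  left : List Dir
  right : List Dir
  below_isDiagram : IsDiagram (ups n) below (left ++ a ++ right)
  above_isDiagram : IsDiagram (left ++ b ++ right) above (ups n)

/-- The place that remains when a place is filled up to a smaller one. -/
def Ctx.fill {a b a' b' : List Dir} (c : Ctx a b) (p q : List Slice) (u w : List Dir)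
    (hp : IsDiagram a p (u ++ a' ++ w)) (hq : IsDiagram (u ++ b' ++ w) q b) : Ctx a' b' where
  n := c.n
  below := c.below ++ p.map (Slice.widen c.left c.right)
  above := q.map (Slice.widen c.left c.right) ++ c.above
  left := c.left ++ u
  right := w ++ c.right
  below_isDiagram := c.below_isDiagram.append (by simpa using hp.widen c.left c.right)
  above_isDiagram := .append (by simpa using hq.widen c.left c.right) c.above_isDiagram

end Words

/-! ### Local skein relations as linear identities -/

section Sem

variable {K : Type*} [CommRing K] (v s : Kˣ)

open Classical in
/-- The element of the skein that a list of slices represents (zero if the slices do not fit). -/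
noncomputable def clsList (n : ℕ) (L : List Slice) : Skein v s n :=
  if h : IsDiagram (ups n) L (ups n) then cls v s ⟨L, h⟩ else 0

theorem clsList_slices {n : ℕ} (D : NTangle n) : clsList v s n D.slices = cls v s D := by
  simp [clsList, D.isDiagram]

/-- The elements of the skeins that a diagram from `a` to `b` represents, in all places where it
fits in. -/
noncomputable def sem (a b : List Dir) (L : List Slice) (c : Ctx a b) : Skein v s c.n :=
  clsList v s c.n (c.below ++ L.map (Slice.widen c.left c.right) ++ c.above)

/-- Insertion into a larger diagram, as a linear map. -/
noncomputable def insertion {a b a' b' : List Dir} (p q : List Slice) (u w : List Dir)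
    (hp : IsDiagram a p (u ++ a' ++ w)) (hq : IsDiagram (u ++ b' ++ w) q b) :
    ((c : Ctx a' b') → Skein v s c.n) →ₗ[K] ((c : Ctx a b) → Skein v s c.n) where
  toFun f c := f (c.fill p q u w hp hq)
  map_add' _ _ := rfl
  map_smul' _ _ := rfl

variable {v s}

theorem insertion_sem {a b a' b' : List Dir} {p q : List Slice} {u w : List Dir}
    (hp : IsDiagram a p (u ++ a' ++ w)) (hq : IsDiagram (u ++ b' ++ w) q b) (L : List Slice) :
    insertion v s p q u w hp hq (sem v s a' b' L) =
      sem v s a b (p ++ L.map (Slice.widen u w) ++ q) := by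
  funext c
  simp [insertion, sem, Ctx.fill]

variable (v s) in
/-- The diagrams `L` and `L'` from `a` to `b` represent the same elements in all places. -/
def SkeinEq (a b : List Dir) (L L' : List Slice) : Prop := sem v s a b L = sem v s a b L'

namespace SkeinEq

variable {a b c : List Dir} {L L' L'' : List Slice}

theorem refl (a b : List Dir) (L : List Slice) : SkeinEq v s a b L L := rfl

theorem symm (h : SkeinEq v s a b L L') : SkeinEq v s a b L' L := Eq.symm h

theorem trans (h : SkeinEq v s a b L L') (h' : SkeinEq v s a b L' L'') : SkeinEq v s a b L L'' :=
  Eq.trans h h'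

/-- Every later application of a move inside a larger diagram goes through this lemma or its special
cases below. It is linearity-free: `insertion` is a function, and equal arguments have equal images.
-/
theorem insert {a' b' : List Dir} (h : SkeinEq v s a' b' L L') (p q : List Slice) (u w : List Dir)
    (hp : IsDiagram a p (u ++ a' ++ w)) (hq : IsDiagram (u ++ b' ++ w) q b) :
    SkeinEq v s a b (p ++ L.map (Slice.widen u w) ++ q) (p ++ L'.map (Slice.widen u w) ++ q) := by
  rw [SkeinEq] at h ⊢
  rw [← insertion_sem hp hq, h, insertion_sem hp hq]

theorem append_right (h : SkeinEq v s a b L L') {q : List Slice} (hq : IsDiagram b q c) :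
    SkeinEq v s a c (L ++ q) (L' ++ q) := by
  simpa using h.insert [] q [] [] (by simp) (by simpa using hq)

theorem append_left (h : SkeinEq v s b c L L') {p : List Slice} (hp : IsDiagram a p b) :
    SkeinEq v s a c (p ++ L) (p ++ L') := by
  simpa using h.insert p [] [] [] (by simpa using hp) (by simp)

theorem widen (h : SkeinEq v s a b L L') (u w : List Dir) :
    SkeinEq v s (u ++ a ++ w) (u ++ b ++ w) (L.map (Slice.widen u w)) (L'.map (Slice.widen u w)) := by
  simpa using h.insert [] [] u w (by simp) (by simp)

end SkeinEq

theorem Ctx.isDiagram {a b : List Dir} (c : Ctx a b) {L : List Slice} (h : IsDiagram a L b) :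
    IsDiagram (ups c.n) (c.below ++ L.map (Slice.widen c.left c.right) ++ c.above) (ups c.n) :=
  (c.below_isDiagram.append (h.widen _ _)).append c.above_isDiagram

theorem sem_eq_cls {a b : List Dir} (c : Ctx a b) {L : List Slice} (h : IsDiagram a L b) :
    sem v s a b L c = cls v s ⟨_, c.isDiagram h⟩ :=
  clsList_slices v s ⟨_, c.isDiagram h⟩

theorem SkeinEq.of_move {a b : List Dir} {L L' : List Slice} (h : Move L L') (hL : IsDiagram a L b)
    (hL' : IsDiagram a L' b) : SkeinEq v s a b L L' := by
  funext c
  rw [sem_eq_cls c hL, sem_eq_cls c hL']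
  exact RingQuot.mkAlgHom_rel K (SkeinRel.move c.below c.above c.left c.right L L' h _ _ rfl rfl)

theorem sem_posCrossing_sub :
    sem v s [.up, .up] [.up, .up] posCrossing - sem v s [.up, .up] [.up, .up] negCrossing =
      ((s : K) - ↑s⁻¹) • sem v s [.up, .up] [.up, .up] [] := by
  funext c
  have ho : ∀ o, IsDiagram [.up, .up] [⟨[], .cross .up .up o, []⟩] [.up, .up] := by simp
  simp only [Pi.sub_apply, Pi.smul_apply]
  rw [posCrossing, negCrossing, sem_eq_cls c (ho _), sem_eq_cls c (ho _), sem_eq_cls c (L := []) rfl]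
  have h := RingQuot.mkAlgHom_rel K (SkeinRel.crossing (v := v) (s := s) c.below c.above
    c.left c.right ⟨_, c.isDiagram (ho true)⟩ ⟨_, c.isDiagram (ho false)⟩ ⟨_, c.isDiagram (L := []) rfl⟩
    rfl rfl rfl)
  rwa [map_sub, map_smul] at h

theorem rightKink_isDiagram : IsDiagram [.up] rightKink [.up] := by
  simp [rightKink, Dir.rev]

theorem leftKink_isDiagram : IsDiagram [.up] leftKink [.up] := by
  simp [leftKink, Dir.rev]

theorem sem_rightKink : sem v s [.up] [.up] rightKink = (↑v⁻¹ : K) • sem v s [.up] [.up] [] := by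
  funext c
  rw [Pi.smul_apply, sem_eq_cls c rightKink_isDiagram, sem_eq_cls c (L := []) rfl]
  have h := RingQuot.mkAlgHom_rel K (SkeinRel.rightKink (v := v) (s := s) c.below c.above
    c.left c.right ⟨_, c.isDiagram rightKink_isDiagram⟩ ⟨_, c.isDiagram (L := []) rfl⟩ rfl rfl)
  rwa [map_smul] at h

theorem sem_leftKink : sem v s [.up] [.up] leftKink = (↑v⁻¹ : K) • sem v s [.up] [.up] [] := by
  funext c
  rw [Pi.smul_apply, sem_eq_cls c leftKink_isDiagram, sem_eq_cls c (L := []) rfl]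
  have h := RingQuot.mkAlgHom_rel K (SkeinRel.leftKink (v := v) (s := s) c.below c.above
    c.left c.right ⟨_, c.isDiagram leftKink_isDiagram⟩ ⟨_, c.isDiagram (L := []) rfl⟩ rfl rfl)
  rwa [map_smul] at h

/-- Equality of the represented elements in all places gives equality in the skein. -/
theorem cls_eq_of_sem {n : ℕ} (D : NTangle n) :
    cls v s D = sem v s (ups n) (ups n) D.slices
      ⟨n, [], [], [], [], by simp, by simp⟩ := by
  simp [sem, clsList_slices]

/-- Slices side by side may change their heights. -/
theorem SkeinEq.slice_comm (S T : Slice) :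
    SkeinEq v s (S.dom ++ T.dom) (S.cod ++ T.cod) [S.widen [] T.dom, T.widen S.cod []]
      [T.widen S.dom [], S.widen [] T.cod] := by
  obtain ⟨l, e, r⟩ := S
  obtain ⟨l', f, r'⟩ := T
  have := (SkeinEq.of_move (v := v) (s := s) (Move.interchange e f (r ++ l'))
    (a := e.dom ++ (r ++ l') ++ f.dom) (b := e.cod ++ (r ++ l') ++ f.cod)
    (by simp) (by simp)).widen l r'
  simpa using this

theorem SkeinEq.slice_list_comm (S : Slice) {c d : List Dir} {L : List Slice}
    (h : IsDiagram c L d) :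
    SkeinEq v s (S.dom ++ c) (S.cod ++ d) (S.widen [] c :: L.map (Slice.widen S.cod []))
      (L.map (Slice.widen S.dom []) ++ [S.widen [] d]) := by
  induction L generalizing c with
  | nil => cases h; exact .refl _ _ _
  | cons T L ih =>
    obtain ⟨rfl, h⟩ := h
    have h1 := (SkeinEq.slice_comm (v := v) (s := s) S T).append_right
      (q := L.map (Slice.widen S.cod [])) (c := S.cod ++ d) (by simpa using h.widen S.cod [])
    have h2 := (ih h).append_left (p := [T.widen S.dom []]) (a := S.dom ++ T.dom) (by simp)
    exact h1.trans h2

/-- Diagrams side by side may change their heights. -/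
theorem SkeinEq.comm {a b c d : List Dir} {L L' : List Slice} (h : IsDiagram a L b)
    (h' : IsDiagram c L' d) :
    SkeinEq v s (a ++ c) (b ++ d) (L.map (Slice.widen [] c) ++ L'.map (Slice.widen b []))
      (L'.map (Slice.widen a []) ++ L.map (Slice.widen [] d)) := by
  induction L generalizing a with
  | nil => cases h; simpa using SkeinEq.refl _ _ _
  | cons S L ih =>
    obtain ⟨rfl, h⟩ := h
    have h1 := (ih h).append_left (p := [S.widen [] c]) (a := S.dom ++ c) (by simp)
    have h2 := (SkeinEq.slice_list_comm (v := v) (s := s) S h').append_right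
      (q := L.map (Slice.widen [] d)) (c := b ++ d) (by simpa using h.widen [] d)
    simpa using h1.trans (by simpa using h2)

end Sem

/-! ### Pulling a tangle through the loop -/

section Slide

/-- An upward string that passes from the left to the right over the strings `x`. -/
def passOver : List Dir → List Slice
  | [] => []
  | b :: x => ⟨[], .cross .up b true, x⟩ :: (passOver x).map (Slice.widen [b] [])

/-- An upward string that passes from the right to the left under the strings `x`. -/
def passUnder : List Dir → List Slice
  | [] => []
  | b :: x => (passUnder x).map (Slice.widen [b] []) ++ [⟨[], .cross b .up true, x⟩]

/-- A loop around the strings `x`. -/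
def loop (x : List Dir) : List Slice :=
  ⟨[], .cup .down, x⟩ :: ((passOver x).map (Slice.widen [.down] []) ++
    ((passUnder x).map (Slice.widen [.down] []) ++ [⟨[], .cap .down, x⟩]))

theorem passOver_isDiagram (x : List Dir) : IsDiagram (.up :: x) (passOver x) (x ++ [.up]) := by
  induction x with
  | nil => simp [passOver]
  | cons b x ih => exact ⟨by simp, by simpa using ih.widen [b] []⟩

theorem passUnder_isDiagram (x : List Dir) : IsDiagram (x ++ [.up]) (passUnder x) (.up :: x) := by
  induction x with
  | nil => simp [passUnder]
  | cons b x ih =>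
    exact .append (b := b :: .up :: x) (by simpa using ih.widen [b] []) (by simp)

theorem passOver_append (x y : List Dir) :
    passOver (x ++ y) = (passOver x).map (Slice.widen [] y) ++ (passOver y).map (Slice.widen x []) := by
  induction x with
  | nil => simp [passOver]
  | cons b x ih => simp [passOver, ih]

theorem passUnder_append (x y : List Dir) :
    passUnder (x ++ y) = (passUnder y).map (Slice.widen x []) ++ (passUnder x).map (Slice.widen [] y) := by
  induction x with
  | nil => simp [passUnder]
  | cons b x ih => simp [passUnder, ih]

variable {K : Type*} [CommRing K] {v s : Kˣ}

theorem SkeinEq.reidemeister2 (a b : Dir) (o : Bool) :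
    SkeinEq v s [a, b] [a, b] [⟨[], .cross a b o, []⟩, ⟨[], .cross b a (!o), []⟩] [] :=
  .of_move (.reidemeister2 a b o) (by simp) (by simp)

/-- A crossing slides below the passing string by the third Reidemeister move, which is allowed for
either sign because that string is over both others. For a minimum or a maximum, a leg slide makes
two crossings with the same leg opposite, and the second Reidemeister move cancels them. -/
theorem passOver_piece (e : Piece) :
    SkeinEq v s (.up :: e.dom) (e.cod ++ [.up]) (passOver e.dom ++ [⟨[], e, [.up]⟩])
      (⟨[.up], e, []⟩ :: passOver e.cod) := by
  cases e with
  | cross a b o =>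
    exact .of_move (.reidemeister3 .up a b true true o (fun _ => rfl)) (by simp [passOver])
      (by simp [passOver])
  | cup a =>
    have h1 : SkeinEq v s [.up] [a, a.rev, .up] _ _ :=
      .append_right (.of_move (.cupSlide a .up true) (a := [.up]) (b := [a, .up, a.rev])
        (by simp) (by simp)) (q := [⟨[a], .cross .up a.rev true, []⟩]) (by simp)
    have h2 : SkeinEq v s [.up] [a, a.rev, .up] _ _ :=
      (SkeinEq.reidemeister2 a.rev .up false).insert [⟨[], .cup a, [.up]⟩] [] [a] []
        (by simp) (by simp)
    exact (h1.trans h2).symm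
  | cap a =>
    have h1 : SkeinEq v s [.up, a, a.rev] [.up] _ _ :=
      .append_left (.of_move (.capSlide a .up true) (a := [a, .up, a.rev]) (b := [.up])
        (by simp) (by simp)) (p := [⟨[], .cross .up a true, [a.rev]⟩]) (by simp)
    have h2 : SkeinEq v s [.up, a, a.rev] [.up] _ _ :=
      (SkeinEq.reidemeister2 .up a true).insert [] [⟨[.up], .cap a, []⟩] [] [a.rev]
        (by simp) (by simp)
    exact h1.trans h2

theorem passUnder_piece (e : Piece) :
    SkeinEq v s (e.dom ++ [.up]) (.up :: e.cod) (passUnder e.dom ++ [⟨[.up], e, []⟩])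
      (⟨[], e, [.up]⟩ :: passUnder e.cod) := by
  cases e with
  | cross a b o =>
    exact .symm (.of_move (.reidemeister3 a b .up o true true (fun h => h.symm)) (by simp [passUnder])
      (by simp [passUnder]))
  | cup a =>
    have h1 : SkeinEq v s [.up] [.up, a, a.rev] _ _ :=
      .append_right (.of_move (.cupSlide a .up false) (a := [.up]) (b := [a, .up, a.rev])
        (by simp) (by simp)) (q := [⟨[], .cross a .up true, [a.rev]⟩]) (by simp)
    have h2 : SkeinEq v s [.up] [.up, a, a.rev] _ _ :=
      (SkeinEq.reidemeister2 .up a false).insert [⟨[.up], .cup a, []⟩] [] [] [a.rev]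
        (by simp) (by simp)
    exact h2.symm.trans h1
  | cap a =>
    have h1 : SkeinEq v s [a, a.rev, .up] [.up] _ _ :=
      .append_left (.of_move (.capSlide a .up false) (a := [a, .up, a.rev]) (b := [.up])
        (by simp) (by simp)) (p := [⟨[a], .cross a.rev .up true, []⟩]) (by simp)
    have h2 : SkeinEq v s [a, a.rev, .up] [.up] _ _ :=
      (SkeinEq.reidemeister2 a.rev .up true).insert [] [⟨[], .cap a, [.up]⟩] [a] []
        (by simp) (by simp)
    exact h1.symm.trans h2

theorem passOver_slide (S : Slice) :
    SkeinEq v s (.up :: S.dom) (S.cod ++ [.up]) (passOver S.dom ++ [S.widen [] [.up]])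
      (S.widen [.up] [] :: passOver S.cod) := by
  obtain ⟨l, e, r⟩ := S
  -- The piece goes down past the crossings with `r` (far commutation), then through the crossings
  -- with its own legs, then past those with `l`.
  have h1 := (SkeinEq.comm (v := v) (s := s) (a := l ++ e.dom) (b := l ++ e.cod)
    (L := [⟨l, e, []⟩]) (by simp) (passOver_isDiagram r)).append_left
    (a := .up :: (l ++ e.dom ++ r)) (p := (passOver (l ++ e.dom)).map (Slice.widen [] r))
    (by simpa using (passOver_isDiagram (l ++ e.dom)).widen [] r)
  have h2 := (passOver_piece (v := v) (s := s) e).insert (a := .up :: (l ++ e.dom ++ r))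
    (b := l ++ e.cod ++ (r ++ [.up]))
    ((passOver l).map (Slice.widen [] (e.dom ++ r))) ((passOver r).map (Slice.widen (l ++ e.cod) [])) l r
    (by simpa using (passOver_isDiagram l).widen [] (e.dom ++ r))
    (by simpa using (passOver_isDiagram r).widen (l ++ e.cod) [])
  have h3 := (SkeinEq.comm (v := v) (s := s) (c := e.dom) (d := e.cod)
    (L' := [⟨[], e, []⟩]) (passOver_isDiagram l) (by simp)).insert (a := .up :: (l ++ e.dom ++ r))
    (b := l ++ e.cod ++ (r ++ [.up]))
    [] ((passOver (e.cod ++ r)).map (Slice.widen l [])) [] r (by simp)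
    (by simpa using (passOver_isDiagram (e.cod ++ r)).widen l [])
  simp [passOver_append] at h1 h2 h3 ⊢
  exact h1.symm.trans (h2.trans h3)

theorem passUnder_slide (S : Slice) :
    SkeinEq v s (S.dom ++ [.up]) (.up :: S.cod) (passUnder S.dom ++ [S.widen [.up] []])
      (S.widen [] [.up] :: passUnder S.cod) := by
  obtain ⟨l, e, r⟩ := S
  have h1 := (SkeinEq.comm (v := v) (s := s) (c := e.dom) (d := e.cod)
    (L' := [⟨[], e, []⟩]) (passUnder_isDiagram l) (by simp)).insert (a := l ++ e.dom ++ (r ++ [.up]))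
    (b := .up :: (l ++ e.cod ++ r))
    ((passUnder (e.dom ++ r)).map (Slice.widen l [])) [] [] r
    (by simpa using (passUnder_isDiagram (e.dom ++ r)).widen l []) (by simp)
  have h2 := (passUnder_piece (v := v) (s := s) e).insert (a := l ++ e.dom ++ (r ++ [.up]))
    (b := .up :: (l ++ e.cod ++ r))
    ((passUnder r).map (Slice.widen (l ++ e.dom) [])) ((passUnder l).map (Slice.widen [] (e.cod ++ r))) l r
    (by simpa using (passUnder_isDiagram r).widen (l ++ e.dom) [])
    (by simpa using (passUnder_isDiagram l).widen [] (e.cod ++ r))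
  have h3 := (SkeinEq.comm (v := v) (s := s) (a := l ++ e.dom) (b := l ++ e.cod)
    (L := [⟨l, e, []⟩]) (by simp) (passUnder_isDiagram r)).append_right
    (c := .up :: (l ++ e.cod ++ r)) (q := (passUnder (l ++ e.cod)).map (Slice.widen [] r))
    (by simpa using (passUnder_isDiagram (l ++ e.cod)).widen [] r)
  simp [passUnder_append] at h1 h2 h3 ⊢
  exact h1.trans (h2.trans h3.symm)

/-- A slice may be moved through a loop around all strings. -/
theorem loop_slide (S : Slice) :
    SkeinEq v s S.dom S.cod (loop S.dom ++ [S]) (S :: loop S.cod) := by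
  -- The slice descends past the maximum of the loop, the arc under the strings, the arc over them,
  -- and the minimum, in this order.
  have h1 := (SkeinEq.slice_comm (v := v) (s := s) ⟨[], .cap .down, []⟩ S).append_left
    (a := S.dom) (p := ⟨[], .cup .down, S.dom⟩ :: ((passOver S.dom).map (Slice.widen [.down] []) ++
      (passUnder S.dom).map (Slice.widen [.down] [])))
    ⟨by simp, .append (b := .down :: (S.dom ++ [.up]))
      (by simpa using (passOver_isDiagram S.dom).widen [.down] [])
      (by simpa using (passUnder_isDiagram S.dom).widen [.down] [])⟩
  have h2 := (passUnder_slide (v := v) (s := s) S).insert (a := S.dom) (b := S.cod)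
    (⟨[], .cup .down, S.dom⟩ :: (passOver S.dom).map (Slice.widen [.down] []))
    [⟨[], .cap .down, S.cod⟩] [.down] []
    ⟨by simp, by simpa using (passOver_isDiagram S.dom).widen [.down] []⟩ (by simp)
  have h3 := (passOver_slide (v := v) (s := s) S).insert (a := S.dom) (b := S.cod)
    [⟨[], .cup .down, S.dom⟩]
    ((passUnder S.cod).map (Slice.widen [.down] []) ++ [⟨[], .cap .down, S.cod⟩]) [.down] []
    (by simp)
    (.append (b := .down :: .up :: S.cod) (by simpa using (passUnder_isDiagram S.cod).widen [.down] [])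
      (by simp))
  have h4 := (SkeinEq.slice_comm (v := v) (s := s) ⟨[], .cup .down, []⟩ S).append_right
    (c := S.cod) (q := ((passOver S.cod).map (Slice.widen [.down] []) ++
      ((passUnder S.cod).map (Slice.widen [.down] []) ++ [⟨[], .cap .down, S.cod⟩])))
    (.append (b := .down :: (S.cod ++ [.up]))
      (by simpa using (passOver_isDiagram S.cod).widen [.down] [])
      (.append (b := .down :: .up :: S.cod) (by simpa using (passUnder_isDiagram S.cod).widen [.down] [])
        (by simp)))
  obtain ⟨l, e, r⟩ := S
  simp [loop] at h1 h2 h3 h4 ⊢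
  exact h1.trans (h2.trans (h3.trans h4))

/-- Intermediate levels of a tangle may contain downward strings, which is why the loop is defined
around an arbitrary word. -/
theorem loop_comm {a b : List Dir} {L : List Slice} (h : IsDiagram a L b) :
    SkeinEq v s a b (loop a ++ L) (L ++ loop b) := by
  induction L generalizing a with
  | nil => cases h; simpa using SkeinEq.refl _ _ _
  | cons S L ih =>
    obtain ⟨rfl, h⟩ := h
    have h1 := (loop_slide (v := v) (s := s) S).append_right h
    have h2 := (ih h).append_left (p := [S]) (a := S.dom) (by simp)
    simpa using h1.trans (by simpa using h2)

end Slide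

/-! ### Kinks and the value of a circle -/

section Kinks

variable {K : Type*} [CommRing K] {v s : Kˣ}

/-- An upward string with a negative kink on its left. -/
def leftNegKink : List Slice :=
  [⟨[], .cup .down, [.up]⟩, ⟨[.down], .cross .up .up false, []⟩, ⟨[], .cap .down, [.up]⟩]

theorem leftNegKink_isDiagram : IsDiagram [.up] leftNegKink [.up] := by
  simp [leftNegKink]

/-- A curl at a minimum and a curl at a maximum of the same string cancel. -/
theorem curls_cancel :
    SkeinEq v s [.up] [.up]
      [⟨[], .cup .down, [.up]⟩, ⟨[], .cross .down .up true, [.up]⟩,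
        ⟨[.up], .cross .down .up false, []⟩, ⟨[.up], .cap .up, []⟩] [] := by
  -- This is the Whitney trick: a cancelling pair of crossings is created below the maximum, so that
  -- a third Reidemeister move becomes possible; afterwards the crossings cancel in other pairs, and
  -- a zigzag is left.
  have h5 : SkeinEq v s [.up] [.up] _ _ :=
    ((SkeinEq.reidemeister2 .up .up false).insert
      [⟨[], .cup .down, [.up]⟩, ⟨[], .cross .down .up true, [.up]⟩,
        ⟨[.up], .cross .down .up false, []⟩] [⟨[.up], .cap .up, []⟩] [] [.down]
      (by simp) (by simp)).symm
  have h6 : SkeinEq v s [.up] [.up] _ _ :=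
    (SkeinEq.of_move (.reidemeister3 .down .up .up true false false (by simp))
      (a := [.down, .up, .up]) (b := [.up, .up, .down]) (by simp) (by simp)).insert
      [⟨[], .cup .down, [.up]⟩] [⟨[], .cross .up .up true, [.down]⟩, ⟨[.up], .cap .up, []⟩] [] []
      (by simp) (by simp)
  have h7 : SkeinEq v s [.up] [.up] _ _ :=
    ((SkeinEq.of_move (.cupSlide .down .up true)
      (a := [.up]) (b := [.down, .up, .up]) (by simp) (by simp)).insert
      [] [⟨[], .cross .down .up false, [.up]⟩, ⟨[.up], .cross .down .up true, []⟩,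
        ⟨[], .cross .up .up true, [.down]⟩, ⟨[.up], .cap .up, []⟩] [] []
      (by simp) (by simp)).symm
  have h8 : SkeinEq v s [.up] [.up] _ _ :=
    (SkeinEq.reidemeister2 .up .down true).insert
      [⟨[.up], .cup .down, []⟩] [⟨[.up], .cross .down .up true, []⟩,
        ⟨[], .cross .up .up true, [.down]⟩, ⟨[.up], .cap .up, []⟩] [] [.up]
      (by simp) (by simp)
  have h9 : SkeinEq v s [.up] [.up] _ _ :=
    ((SkeinEq.of_move (.capSlide .up .up false)
      (a := [.up, .up, .down]) (b := [.up]) (by simp) (by simp)).insert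
      [⟨[.up], .cup .down, []⟩, ⟨[.up], .cross .down .up true, []⟩] [] [] []
      (by simp) (by simp)).symm
  have h10 : SkeinEq v s [.up] [.up] _ _ :=
    (SkeinEq.reidemeister2 .down .up true).insert
      [⟨[.up], .cup .down, []⟩] [⟨[], .cap .up, [.up]⟩] [.up] []
      (by simp) (by simp)
  have h11 : SkeinEq v s [.up] [.up] _ _ :=
    SkeinEq.of_move (.zigzag_left .up) (by simp) (by simp)
  exact h5.trans (h6.trans (h7.trans (h8.trans (h9.trans (h10.trans h11)))))

/-- Kinks of opposite signs on both sides of a string cancel. -/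
theorem rightKink_leftNegKink : SkeinEq v s [.up] [.up] (rightKink ++ leftNegKink) [] := by
  -- Leg slides move the crossing of each kink to the other leg, so that the kinks become curls at a
  -- maximum and a minimum. Height changes then bring the minimum of the first kink next to the
  -- maximum of the second one, and the two are straightened.
  have h1 : SkeinEq v s [.up] [.up] _ _ :=
    (SkeinEq.of_move (.cupSlide .up .up true)
      (a := [.up]) (b := [.up, .up, .down]) (by simp) (by simp)).insert
      [] (⟨[.up], .cap .up, []⟩ :: leftNegKink) [] [] (by simp) (by simp [leftNegKink])
  have h2 : SkeinEq v s [.up] [.up] _ _ :=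
    (SkeinEq.of_move (.capSlide .down .up false)
      (a := [.down, .up, .up]) (b := [.up]) (by simp) (by simp)).insert
      [⟨[], .cup .up, [.up]⟩, ⟨[.up], .cross .down .up false, []⟩, ⟨[.up], .cap .up, []⟩,
        ⟨[], .cup .down, [.up]⟩] [] [] [] (by simp) (by simp)
  have h3 : SkeinEq v s [.up] [.up] _ _ :=
    ((SkeinEq.comm (a := [.up]) (b := [.up, .down, .up]) (c := [.down, .up]) (d := [])
      (L := [⟨[], .cup .down, [.up]⟩, ⟨[], .cross .down .up true, [.up]⟩])
      (L' := [⟨[], .cross .down .up false, []⟩, ⟨[], .cap .up, []⟩])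
      (by simp) (by simp)).insert
      [⟨[], .cup .up, [.up]⟩] [⟨[.up], .cap .down, []⟩] [] [] (by simp) (by simp)).symm
  have h4 : SkeinEq v s [.up] [.up] _ _ :=
    ((SkeinEq.comm (a := []) (b := [.up, .down]) (c := [.up]) (d := [.up, .down, .up])
      (L := [⟨[], .cup .down, []⟩, ⟨[], .cross .down .up true, []⟩])
      (L' := [⟨[], .cup .up, [.up]⟩])
      (by simp) (by simp)).insert
      [] [⟨[.up, .down, .up], .cross .down .up false, []⟩, ⟨[.up, .down, .up], .cap .up, []⟩,
        ⟨[.up], .cap .down, []⟩] [] [] (by simp) (by simp)).symm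
  have h5 : SkeinEq v s [.up] [.up] _ _ :=
    ((SkeinEq.comm (a := [.up, .down, .up]) (b := [.up]) (c := [.down, .up]) (d := [])
      (L := [⟨[.up], .cap .down, []⟩])
      (L' := [⟨[], .cross .down .up false, []⟩, ⟨[], .cap .up, []⟩])
      (by simp) (by simp)).insert
      [⟨[], .cup .down, [.up]⟩, ⟨[], .cross .down .up true, [.up]⟩,
        ⟨[.up, .down], .cup .up, [.up]⟩] [] [] [] (by simp) (by simp)).symm
  have h6 : SkeinEq v s [.up] [.up] _ _ :=
    (SkeinEq.of_move (.zigzag_left .down) (a := [.down]) (b := [.down]) (by simp) (by simp)).insert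
      [⟨[], .cup .down, [.up]⟩, ⟨[], .cross .down .up true, [.up]⟩]
      [⟨[.up], .cross .down .up false, []⟩, ⟨[.up], .cap .up, []⟩] [.up] [.up]
      (by simp) (by simp)
  exact h1.trans (h2.trans (h3.trans (h4.trans (h5.trans (h6.trans curls_cancel)))))

theorem sem_leftNegKink : sem v s [.up] [.up] leftNegKink = (v : K) • sem v s [.up] [.up] [] := by
  have hp : IsDiagram [.up] [] ([] ++ [.up] ++ []) := rfl
  -- Stacking the negative left kink on the relation for the right kink makes `v⁻¹` times the
  -- negative kink equal to the plain string.
  have h := congrArg (insertion v s [] leftNegKink [] [] hp leftNegKink_isDiagram)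
    (sem_rightKink (v := v) (s := s))
  rw [map_smul, insertion_sem, insertion_sem] at h
  have h' : (↑v⁻¹ : K) • sem v s [.up] [.up] leftNegKink = sem v s [.up] [.up] [] :=
    (Eq.symm (by simpa using h)).trans (rightKink_leftNegKink (v := v) (s := s))
  rw [← h', smul_smul, Units.mul_inv, one_smul]

/-- The value of a circle to the left of an upward string. -/
theorem sem_circle (z : Kˣ) (hz : (z : K) = (s : K) - ↑s⁻¹) :
    sem v s [.up] [.up] [⟨[], .cup .down, [.up]⟩, ⟨[], .cap .down, [.up]⟩] =
      ((↑v⁻¹ - ↑v) * ↑z⁻¹ : K) • sem v s [.up] [.up] [] := by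
  have hp : IsDiagram [.up] [⟨[], .cup .down, [.up]⟩] ([.down] ++ [.up, .up] ++ []) := by simp
  have hq : IsDiagram ([.down] ++ [.up, .up] ++ []) [⟨[], .cap .down, [.up]⟩] [.up] := by simp
  -- Smoothing the crossing of a left kink leaves a circle beside the string.
  have h := congrArg (insertion v s _ _ _ _ hp hq) (sem_posCrossing_sub (v := v) (s := s))
  rw [map_sub, map_smul, insertion_sem, insertion_sem, insertion_sem, ← hz] at h
  have h' : sem v s [.up] [.up] leftKink - sem v s [.up] [.up] leftNegKink = (z : K) •
      sem v s [.up] [.up] [⟨[], .cup .down, [.up]⟩, ⟨[], .cap .down, [.up]⟩] := h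
  rw [sem_leftKink, sem_leftNegKink] at h'
  rw [mul_comm, mul_smul, (sub_smul _ _ (sem v s [.up] [.up] [])).trans h', smul_smul, Units.inv_mul, one_smul]

end Kinks

/-! ### Hills and valleys in the braid monoid -/

section Hill

/-- The word `i, i + 1, …, i + k, …, i + 1, i`. -/
def hill (i k : ℕ) : List ℕ := List.range' i k ++ (i + k) :: (List.range' i k).reverse

/-- The word `i + k, …, i + 1, i, i + 1, …, i + k`. -/
def valley (i k : ℕ) : List ℕ := (List.range' (i + 1) k).reverse ++ i :: List.range' (i + 1) k

theorem hill_succ (i k : ℕ) : hill i (k + 1) = i :: hill (i + 1) k ++ [i] := by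
  simp [hill, List.range'_succ]
  omega

theorem valley_succ (i k : ℕ) :
    valley i (k + 1) = (i + k + 1) :: valley i k ++ [i + k + 1] := by
  have h : i + 1 + k = i + k + 1 := by omega
  simp [valley, List.range'_1_concat, h]

theorem mem_hill {i k m : ℕ} : m ∈ hill i k ↔ i ≤ m ∧ m ≤ i + k := by
  simp [hill, List.mem_range'_1]
  omega

theorem mem_valley {i k m : ℕ} : m ∈ valley i k ↔ i ≤ m ∧ m ≤ i + k := by
  simp [valley, List.mem_range'_1]
  omega

/-- In a monoid, a product over a hill is the product over the valley. -/
theorem prod_hill {G : Type*} [Monoid G] {g : ℕ → G} {n : ℕ}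
    (hb : ∀ i, 1 ≤ i → i + 1 < n → g i * g (i + 1) * g i = g (i + 1) * g i * g (i + 1))
    (hc : ∀ i j, 1 ≤ i → i + 2 ≤ j → j < n → g i * g j = g j * g i) {i k : ℕ} (hi : 1 ≤ i)
    (hk : i + k < n) : ((hill i k).map g).prod = ((valley i k).map g).prod := by
  induction k using Nat.strong_induction_on generalizing i with
  | _ k ih =>
    match k with
    | 0 => simp [hill, valley]
    | 1 =>
      simpa [hill, valley, mul_assoc] using hb i hi hk
    | k + 2 =>
      -- Let `t = i + k + 2` be the top letter. The hill inside the two letters `i` becomes a valley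
      -- `t y t`; as `i` and `t` are at least two apart, they commute; the word `i y i` left in the
      -- middle comes from a shorter hill and becomes a valley too. For `k = 1` the letters are
      -- adjacent, hence the separate case above.
      have h1 := ih (k + 1) (by omega) (i := i + 1) (by omega) (by omega)
      have h2 := ih k (by omega) (i := i + 1) (by omega) (by omega)
      have h3 := ih (k + 1) (by omega) (i := i) (by omega) (by omega)
      have hj := hc i (i + k + 2) hi (by omega) (by omega)
      have e : i + 1 + k + 1 = i + k + 2 := by omega
      have e' : i + (k + 1) + 1 = i + k + 2 := by omega
      rw [valley_succ, e] at h1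
      rw [hill_succ] at h3
      rw [hill_succ, valley_succ, e']
      simp only [List.map_append, List.map_cons, List.map_nil, List.prod_append, List.prod_cons,
        List.prod_nil, mul_one] at h1 h2 h3 ⊢
      rw [h1, ← h3, h2]
      generalize ((valley (i + 1) k).map g).prod = y at *
      calc g i * (g (i + k + 2) * y * g (i + k + 2)) * g i
          = (g i * g (i + k + 2)) * y * (g (i + k + 2) * g i) := by simp only [mul_assoc]
        _ = g (i + k + 2) * g i * y * (g i * g (i + k + 2)) := by rw [hj]
        _ = _ := by simp only [mul_assoc]

end Hill

/-! ### Braid relations in the skein -/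

section Braids

variable {K : Type*} [CommRing K] {v s : Kˣ}

theorem ups_append (m n : ℕ) : ups m ++ ups n = ups (m + n) := by simp [ups]

theorem ups_succ (n : ℕ) : ups (n + 1) = .up :: ups n := rfl

theorem braid_isDiagram {n : ℕ} {l : List ℕ} (h : ∀ i ∈ l, 1 ≤ i ∧ i < n) :
    IsDiagram (ups n) (l.map (sigmaSlice n)) (ups n) :=
  .of_forall (List.forall_mem_map.2 fun i hi =>
    ⟨(sigmaSlice_dom (h i hi)).symm, sigmaSlice_cod (h i hi)⟩)

theorem slices_prod_sigma {n : ℕ} {l : List ℕ} (h : ∀ i ∈ l, 1 ≤ i ∧ i < n) :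
    (l.map (sigma n)).prod.slices = l.map (sigmaSlice n) := by
  induction l with
  | nil => rfl
  | cons i l ih =>
    have hi := h i (by simp)
    have := ih fun j hj => h j (by simp [hj])
    simp only [List.map_cons, List.prod_cons]
    change (sigma n i).slices ++ _ = _
    rw [this, sigma, dif_pos hi]
    rfl

theorem slices_omega {n i k : ℕ} (hi : 1 ≤ i) (hk : i + k < n) :
    (omega n i (i + k + 1)).slices = (hill i k).map (sigmaSlice n) := by
  rw [← slices_prod_sigma (fun m hm => by rw [mem_hill] at hm; omega), omega, hill]
  have e : i + k + 1 - i = k + 1 := by omega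
  have e' : i + k + 1 - 1 - i = k := by omega
  rw [e, e', List.range'_1_concat]
  simp [mul_assoc]

theorem braid_relation {n i : ℕ} (hi : 1 ≤ i) (hn : i + 1 < n) :
    SkeinEq v s (ups n) (ups n) ([i, i + 1, i].map (sigmaSlice n))
      ([i + 1, i, i + 1].map (sigmaSlice n)) := by
  obtain ⟨i, rfl⟩ := Nat.exists_eq_add_of_le' hi
  obtain ⟨r, rfl⟩ := Nat.exists_eq_add_of_le' hn
  have h := (SkeinEq.of_move (v := v) (s := s)
    (.reidemeister3 .up .up .up true true true (by simp)) (a := ups 3) (b := ups 3)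
    (by simp [ups]) (by simp [ups])).widen (ups i) (ups r)
  have e : ups i ++ ups 3 ++ ups r = ups (r + (i + 1 + 1).succ) := by
    rw [ups_append, ups_append]
    congr 1
    omega
  have e1 : [Dir.up] ++ ups r = ups (r + 1) := rfl
  have e2 : ups i ++ [Dir.up] = ups (i + 1) := by rw [← ups_append]; rfl
  rw [e] at h
  simp only [List.map_cons, List.map_nil, Slice.widen, e1, e2, List.append_nil, List.nil_append] at h
  have e3 : r + (i + 1 + 1).succ - 1 - (i + 1) = r + 1 := by omega
  have e4 : r + (i + 1 + 1).succ - 1 - (i + 1 + 1) = r := by omega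
  simp only [sigmaSlice, List.map_cons, List.map_nil, e3, e4, Nat.add_sub_cancel]
  exact h

theorem braid_comm {n i j : ℕ} (hi : 1 ≤ i) (hij : i + 2 ≤ j) (hj : j < n) :
    SkeinEq v s (ups n) (ups n) ([i, j].map (sigmaSlice n)) ([j, i].map (sigmaSlice n)) := by
  obtain ⟨i, rfl⟩ := Nat.exists_eq_add_of_le' hi
  obtain ⟨m, rfl⟩ := Nat.exists_eq_add_of_le' hij
  obtain ⟨r, rfl⟩ := Nat.exists_eq_add_of_le' hj
  have h := SkeinEq.slice_comm (v := v) (s := s) (sigmaSlice (i + 2) (i + 1))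
    (sigmaSlice (m + r + 2) (m + 1))
  rw [sigmaSlice_dom (by omega), sigmaSlice_dom (by omega), sigmaSlice_cod (by omega),
    sigmaSlice_cod (by omega), ups_append] at h
  have e1 : i + 2 + (m + r + 2) = r + (m + (i + 1 + 2)).succ := by omega
  have e2 : i + 2 - 1 - (i + 1) + (m + r + 2) = r + (m + (i + 1 + 2)).succ - 1 - (i + 1) := by omega
  have e3 : m + r + 2 - 1 - (m + 1) = r + (m + (i + 1 + 2)).succ - 1 - (m + (i + 1 + 2)) := by omega
  have e4 : i + 2 + (m + 1 - 1) = m + (i + 1 + 2) - 1 := by omega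
  simp only [Slice.widen, sigmaSlice, List.nil_append, List.append_nil, ups_append] at h
  rw [e1, e2, e3, e4] at h
  exact h

variable (v s) in
/-- Diagrams of `n`-tangles that represent the same elements in all places. -/
def skeinCon (n : ℕ) : Con (NTangle n) where
  r D E := SkeinEq v s (ups n) (ups n) D.slices E.slices
  iseqv := ⟨fun _ => .refl _ _ _, fun h => h.symm, fun h h' => h.trans h'⟩
  mul' {_ D' E _} h h' := (h.append_right E.isDiagram).trans (h'.append_left D'.isDiagram)

/-- The dictionary between words in the quotient monoid, to which `prod_hill` applies, and stacks of
slices. -/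
theorem prod_sigma_eq_iff {n : ℕ} {l l' : List ℕ} (hl : ∀ i ∈ l, 1 ≤ i ∧ i < n)
    (hl' : ∀ i ∈ l', 1 ≤ i ∧ i < n) :
    (l.map fun i => (sigma n i : (skeinCon v s n).Quotient)).prod =
        (l'.map fun i => (sigma n i : (skeinCon v s n).Quotient)).prod ↔
      SkeinEq v s (ups n) (ups n) (l.map (sigmaSlice n)) (l'.map (sigmaSlice n)) := by
  have key : ∀ l : List ℕ, (l.map fun i => (sigma n i : (skeinCon v s n).Quotient)).prod =
      (((l.map (sigma n)).prod : NTangle n) : (skeinCon v s n).Quotient) := by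
    intro l
    induction l with
    | nil => rfl
    | cons i l ih => simp only [List.map_cons, List.prod_cons, ih, Con.coe_mul]
  rw [key, key, Con.eq, ← slices_prod_sigma hl, ← slices_prod_sigma hl']
  exact Iff.rfl

theorem skeinEq_hill_valley {n i k : ℕ} (hi : 1 ≤ i) (hk : i + k < n) :
    SkeinEq v s (ups n) (ups n) ((hill i k).map (sigmaSlice n))
      ((valley i k).map (sigmaSlice n)) := by
  refine (prod_sigma_eq_iff (fun m hm => by rw [mem_hill] at hm; omega)
    (fun m hm => by rw [mem_valley] at hm; omega)).1 (prod_hill (n := n) ?_ ?_ hi hk)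
  · intro i hi hn
    simpa [mul_assoc] using (prod_sigma_eq_iff (by simp; omega) (by simp; omega)).2
      (braid_relation (v := v) (s := s) hi hn)
  · intro i j hi hij hj
    simpa using (prod_sigma_eq_iff (by simp; omega) (by simp; omega)).2
      (braid_comm (v := v) (s := s) hi hij hj)

end Braids

/-! ### Expansion of full turns by the quadratic relation -/

section Expansion

variable {K : Type*} [CommRing K] {v s : Kˣ}

/-- Switching the lower crossing gives a pair that cancels by the second Reidemeister move;
smoothing it leaves one crossing. -/
theorem sem_crossing_sq (z : Kˣ) (hz : (z : K) = (s : K) - ↑s⁻¹) :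
    sem v s [.up, .up] [.up, .up] (posCrossing ++ posCrossing) =
      sem v s [.up, .up] [.up, .up] [] + (z : K) • sem v s [.up, .up] [.up, .up] posCrossing := by
  have hp : IsDiagram [.up, .up] [] ([] ++ [.up, .up] ++ []) := rfl
  have hq : IsDiagram ([] ++ [.up, .up] ++ []) posCrossing [.up, .up] := by simp [posCrossing]
  have h := congrArg (insertion v s _ _ _ _ hp hq) (sem_posCrossing_sub (v := v) (s := s))
  rw [map_sub, map_smul, insertion_sem, insertion_sem, insertion_sem, ← hz] at h
  have h' : sem v s [.up, .up] [.up, .up] (posCrossing ++ posCrossing) -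
      sem v s [.up, .up] [.up, .up] (negCrossing ++ posCrossing) =
      (z : K) • sem v s [.up, .up] [.up, .up] posCrossing := h
  have h2 : sem v s [.up, .up] [.up, .up] (negCrossing ++ posCrossing) =
      sem v s [.up, .up] [.up, .up] [] := SkeinEq.reidemeister2 .up .up false
  rw [h2] at h'
  exact (sub_eq_iff_eq_add'.1 h')

theorem sem_braid_sq (z : Kˣ) (hz : (z : K) = (s : K) - ↑s⁻¹) {n i : ℕ} {l l' : List ℕ}
    (hi : 1 ≤ i ∧ i < n) (hl : ∀ i ∈ l, 1 ≤ i ∧ i < n) (hl' : ∀ i ∈ l', 1 ≤ i ∧ i < n) :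
    sem v s (ups n) (ups n) ((l ++ i :: i :: l').map (sigmaSlice n)) =
      sem v s (ups n) (ups n) ((l ++ l').map (sigmaSlice n)) +
        (z : K) • sem v s (ups n) (ups n) ((l ++ i :: l').map (sigmaSlice n)) := by
  have e : ups (i - 1) ++ [.up, .up] ++ ups (n - 1 - i) = ups n := sigmaSlice_dom hi
  have h := congrArg (insertion v s (l.map (sigmaSlice n)) (l'.map (sigmaSlice n)) (ups (i - 1))
    (ups (n - 1 - i)) (a := ups n) (b := ups n) (by rw [e]; exact braid_isDiagram hl)
    (by rw [e]; exact braid_isDiagram hl')) (sem_crossing_sq (v := v) z hz)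
  rw [map_add, map_smul, insertion_sem, insertion_sem, insertion_sem] at h
  simpa [posCrossing, sigmaSlice] using h

/-- The expansion of a full turn of the first string around the next `k` strings. -/
theorem sem_range_append_reverse (z : Kˣ) (hz : (z : K) = (s : K) - ↑s⁻¹) {n k : ℕ} (hk : k < n) :
    sem v s (ups n) (ups n)
        ((List.range' 1 k ++ (List.range' 1 k).reverse).map (sigmaSlice n)) =
      sem v s (ups n) (ups n) [] + (z : K) • ∑ m ∈ Finset.range k,
        sem v s (ups n) (ups n) ((hill 1 m).map (sigmaSlice n)) := by
  induction k with
  | zero => simp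
  | succ k ih =>
    have hl : ∀ i ∈ List.range' 1 k, 1 ≤ i ∧ i < n := fun i hi => by
      rw [List.mem_range'_1] at hi
      omega
    -- The square resolved is that of the innermost letter `1 + k`: deleting it leaves the shorter
    -- turn, keeping one copy leaves `hill 1 k`.
    have h := sem_braid_sq (v := v) z hz (i := 1 + k) (by omega) hl
      (l' := (List.range' 1 k).reverse) (by simpa using hl)
    rw [Finset.sum_range_succ, smul_add, ← add_assoc, ← ih (by omega), hill, ← h,
      List.range'_1_concat]
    simp

/-- The expansion of a full turn of the last string around the `k` strings before it. -/
theorem sem_reverse_append_range (z : Kˣ) (hz : (z : K) = (s : K) - ↑s⁻¹) {n i k : ℕ} (hi : 1 ≤ i)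
    (hk : i + k ≤ n) :
    sem v s (ups n) (ups n)
        (((List.range' i k).reverse ++ List.range' i k).map (sigmaSlice n)) =
      sem v s (ups n) (ups n) [] + (z : K) • ∑ m ∈ Finset.range k,
        sem v s (ups n) (ups n) ((valley (i + k - 1 - m) m).map (sigmaSlice n)) := by
  induction k generalizing i with
  | zero => simp
  | succ k ih =>
    have hl : ∀ j ∈ List.range' (i + 1) k, 1 ≤ j ∧ j < n := fun j hj => by
      rw [List.mem_range'_1] at hj
      omega
    have h := sem_braid_sq (v := v) z hz (i := i) (l := (List.range' (i + 1) k).reverse) (by omega)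
      (by simpa using hl) hl
    have ih := ih (i := i + 1) (by omega) (by omega)
    have e : i + 1 + k - 1 = i + (k + 1) - 1 := by omega
    have e' : i + (k + 1) - 1 - k = i := by omega
    rw [e] at ih
    rw [Finset.sum_range_succ, smul_add, ← add_assoc, ← ih, e', valley, ← h, List.range'_succ]
    simp

end Expansion

/-! ### Closing the first string -/

section Closure

variable {K : Type*} [CommRing K] {v s : Kˣ}

theorem closure_isDiagram_below (n : ℕ) :
    IsDiagram (ups n) [⟨[], .cup .down, ups n⟩] ([.down] ++ ups (n + 1) ++ []) := by
  simp [ups_succ]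

theorem closure_isDiagram_above (n : ℕ) :
    IsDiagram ([.down] ++ ups (n + 1) ++ []) [⟨[], .cap .down, ups n⟩] (ups n) := by
  simp [ups_succ]

variable (v s) in
/-- The closure of the first one of `n + 1` strings. -/
noncomputable def closure (n : ℕ) :
    ((c : Ctx (ups (n + 1)) (ups (n + 1))) → Skein v s c.n) →ₗ[K]
      ((c : Ctx (ups n) (ups n)) → Skein v s c.n) :=
  insertion v s _ _ _ _ (closure_isDiagram_below n) (closure_isDiagram_above n)

theorem closure_sem (n : ℕ) (L : List Slice) :
    closure v s n (sem v s (ups (n + 1)) (ups (n + 1)) L) =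
      sem v s (ups n) (ups n)
        (⟨[], .cup .down, ups n⟩ :: L.map (Slice.widen [.down] []) ++ [⟨[], .cap .down, ups n⟩]) :=
  insertion_sem (closure_isDiagram_below n) (closure_isDiagram_above n) L

/-- At least one string must remain, because the circle is evaluated next to an upward string. -/
theorem closure_one (z : Kˣ) (hz : (z : K) = (s : K) - ↑s⁻¹) (n : ℕ) :
    closure v s (n + 1) (sem v s (ups (n + 1 + 1)) (ups (n + 1 + 1)) []) =
      ((↑v⁻¹ - ↑v) * ↑z⁻¹ : K) • sem v s (ups (n + 1)) (ups (n + 1)) [] := by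
  have hp : IsDiagram (ups (n + 1)) [] ([] ++ [.up] ++ ups n) := rfl
  have hq : IsDiagram ([] ++ [.up] ++ ups n) [] (ups (n + 1)) := rfl
  have h := congrArg (insertion v s _ _ _ _ hp hq) (sem_circle (v := v) z hz)
  rw [map_smul, insertion_sem, insertion_sem] at h
  rw [closure_sem]
  exact h

theorem sigmaSlice_succ {n i : ℕ} (hi : 1 ≤ i) :
    sigmaSlice (n + 1) (i + 1) = (sigmaSlice n i).widen [.up] [] := by
  obtain ⟨i, rfl⟩ := Nat.exists_eq_add_of_le' hi
  have e : n - (i + 1 + 1) = n - 1 - (i + 1) := by omega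
  simp [sigmaSlice, ups_succ, e]

theorem map_sigmaSlice_range' (n k : ℕ) :
    (List.range' 2 k).map (sigmaSlice (n + 1)) =
      ((List.range' 1 k).map (sigmaSlice n)).map (Slice.widen [.up] []) := by
  rw [List.range'_succ_left, List.map_map, List.map_map]
  refine List.map_congr_left fun i hi => ?_
  rw [List.mem_range'_1] at hi
  exact sigmaSlice_succ hi.1

theorem closure_valley {n m : ℕ} (hm : m < n) :
    closure v s n (sem v s (ups (n + 1)) (ups (n + 1)) ((valley 1 m).map (sigmaSlice (n + 1)))) =
      (↑v⁻¹ : K) • sem v s (ups n) (ups n)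
        (((List.range' 1 m).reverse ++ List.range' 1 m).map (sigmaSlice n)) := by
  obtain ⟨n, rfl⟩ : ∃ k, n = k + 1 := ⟨n - 1, by omega⟩
  have hl : ∀ i ∈ List.range' 1 m, 1 ≤ i ∧ i < n + 1 := fun i hi => by
    rw [List.mem_range'_1] at hi
    omega
  have hB : IsDiagram (ups (n + 1)) ((List.range' 1 m).map (sigmaSlice (n + 1))) (ups (n + 1)) :=
    braid_isDiagram hl
  have hB' : IsDiagram (ups (n + 1)) ((List.range' 1 m).reverse.map (sigmaSlice (n + 1)))
    (ups (n + 1)) := braid_isDiagram (by simpa using hl)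
  have hp : IsDiagram (ups (n + 1)) ((List.range' 1 m).reverse.map (sigmaSlice (n + 1)))
    ([] ++ [.up] ++ ups n) := hB'
  have hq : IsDiagram ([] ++ [.up] ++ ups n) ((List.range' 1 m).map (sigmaSlice (n + 1)))
    (ups (n + 1)) := hB
  have h := congrArg (insertion v s _ _ _ _ hp hq) (sem_leftKink (v := v) (s := s))
  rw [map_smul, insertion_sem, insertion_sem] at h
  rw [List.map_append]
  refine Eq.trans ?_ (h.trans (by simp))
  rw [closure_sem]
  -- The two slopes of the valley avoid the first string, so the lower one drops below the minimum
  -- of the closing arc and the upper one rises above its maximum. What remains between them is a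
  -- left kink.
  have h1 := (SkeinEq.comm (v := v) (s := s) (a := []) (b := [.down, .up])
    (L := [⟨[], .cup .down, []⟩]) (by simp) hB').append_right
    (q := ⟨[.down], .cross .up .up true, ups n⟩ ::
      (((List.range' 1 m).map (sigmaSlice (n + 1))).map (Slice.widen [.down, .up] []) ++
        [⟨[], .cap .down, ups (n + 1)⟩])) (c := ups (n + 1))
    ⟨by simp [ups_succ], .append (b := .down :: .up :: ups (n + 1))
      (by simpa [ups_succ] using hB.widen [.down, .up] []) (by simp)⟩
  have h2 := (SkeinEq.comm (v := v) (s := s) (a := [.down, .up]) (b := [])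
    (L := [⟨[], .cap .down, []⟩]) (by simp) hB).append_left
    (p := (List.range' 1 m).reverse.map (sigmaSlice (n + 1)) ++
      [⟨[], .cup .down, ups (n + 1)⟩, ⟨[.down], .cross .up .up true, ups n⟩]) (a := ups (n + 1))
    (.append hB' (by simp [ups_succ]))
  have e : sigmaSlice (n + 1 + 1) 1 = ⟨[], .cross .up .up true, ups n⟩ := rfl
  have e' : Dir.up :: ups n = ups (n + 1) := rfl
  have h3 : SkeinEq v s (ups (n + 1)) (ups (n + 1)) _ _ := h1.trans (by simpa using h2.symm)
  rw [valley, List.map_append, List.map_reverse, List.map_cons, map_sigmaSlice_range', e]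
  simpa [leftKink, SkeinEq, e', List.map_reverse, ← Function.comp_assoc] using h3

end Closure

/-! ### The encircled identity braid -/

section Encircled

variable {K : Type*} [CommRing K] {v s : Kˣ}

theorem passOver_ups (n : ℕ) :
    passOver (ups n) = (List.range' 1 n).map (sigmaSlice (n + 1)) := by
  induction n with
  | zero => rfl
  | succ n ih =>
    rw [ups_succ, passOver, ih, List.range'_succ, List.map_cons, map_sigmaSlice_range' (n + 1) n]
    rfl

theorem passUnder_ups (n : ℕ) :
    passUnder (ups n) = (List.range' 1 n).reverse.map (sigmaSlice (n + 1)) := by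
  induction n with
  | zero => rfl
  | succ n ih =>
    rw [ups_succ, passUnder, ih, List.range'_succ, List.reverse_cons, List.map_append,
      List.map_reverse (l := List.range' (1 + 1) n), map_sigmaSlice_range' (n + 1) n,
      List.map_reverse, List.map_reverse]
    rfl

theorem slices_encircled (n : ℕ) : (encircled n).slices = loop (ups n) := by
  simp only [encircled, loopSlices, loop, passOver_ups, passUnder_ups, List.map_map,
    List.append_assoc, List.singleton_append]
  rfl

theorem sem_loop (z : Kˣ) (hz : (z : K) = (s : K) - ↑s⁻¹) {n : ℕ} (hn : 1 ≤ n) :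
    sem v s (ups n) (ups n) (loop (ups n)) =
      ((z : K) ^ 2 * ↑v⁻¹) • ∑ m ∈ Finset.range n, ∑ l ∈ Finset.range m,
          sem v s (ups n) (ups n) ((hill (m - l) l).map (sigmaSlice n)) +
        ((n : K) * z * ↑v⁻¹ + (↑v⁻¹ - ↑v) * ↑z⁻¹) • sem v s (ups n) (ups n) [] := by
  have h := congrArg (closure v s n) (sem_range_append_reverse (v := v) z hz (Nat.lt_succ_self n))
  have h0 : closure v s n (sem v s (ups (n + 1)) (ups (n + 1)) []) =
      ((↑v⁻¹ - ↑v) * ↑z⁻¹ : K) • sem v s (ups n) (ups n) [] := by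
    obtain ⟨n, rfl⟩ : ∃ k, n = k + 1 := ⟨n - 1, by omega⟩
    exact closure_one z hz n
  have h1 : ∀ m ∈ Finset.range n, closure v s n
      (sem v s (ups (n + 1)) (ups (n + 1)) ((hill 1 m).map (sigmaSlice (n + 1)))) =
        (↑v⁻¹ : K) • (sem v s (ups n) (ups n) [] + (z : K) • ∑ l ∈ Finset.range m,
          sem v s (ups n) (ups n) ((hill (m - l) l).map (sigmaSlice n))) := by
    -- Hill to valley, so that the closure is a kink; then the second expansion; then valleys back
    -- to hills, which are the words of the permutation braids.
    intro m hm
    rw [Finset.mem_range] at hm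
    have e : sem v s (ups (n + 1)) (ups (n + 1)) ((hill 1 m).map (sigmaSlice (n + 1))) =
        sem v s (ups (n + 1)) (ups (n + 1)) ((valley 1 m).map (sigmaSlice (n + 1))) :=
      skeinEq_hill_valley le_rfl (by omega)
    rw [e, closure_valley hm, sem_reverse_append_range z hz le_rfl (by omega)]
    congr 3
    refine Finset.sum_congr rfl fun l hl => ?_
    rw [Finset.mem_range] at hl
    rw [Nat.add_sub_cancel_left]
    exact (skeinEq_hill_valley (by omega) (by omega)).symm
  rw [closure_sem, map_add, map_smul, map_sum, Finset.sum_congr rfl h1, h0] at h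
  have h2 : loop (ups n) = ⟨[], .cup .down, ups n⟩ ::
      ((List.range' 1 n ++ (List.range' 1 n).reverse).map (sigmaSlice (n + 1))).map
        (Slice.widen [.down] []) ++ [⟨[], .cap .down, ups n⟩] := by
    simp [loop, passOver_ups, passUnder_ups]
  rw [h2, h, ← Finset.smul_sum, Finset.sum_add_distrib, ← Finset.smul_sum, Finset.sum_const,
    Finset.card_range]
  module

/-- Reindexing by `j = m + 1` and `i = m - l`, as produced by the expansion; the term `m = 0` is an
empty sum. -/
theorem murphySum_eq (n : ℕ) :
    murphySum v s n = ∑ m ∈ Finset.range n, ∑ l ∈ Finset.range m,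
      cls v s (omega n (m - l) (m + 1)) := by
  have h1 : ∀ m, murphy v s n (m + 1) = ∑ l ∈ Finset.range m, cls v s (omega n (m - l) (m + 1)) := by
    intro m
    rw [murphy, Finset.sum_Ico_eq_sum_range, ← Finset.sum_range_reflect]
    refine Finset.sum_congr (by simp) fun l hl => ?_
    rw [Finset.mem_range] at hl
    congr 2
    omega
  rw [murphySum, Finset.range_eq_Ico]
  have h2 : Finset.Icc 2 n = (Finset.Ico 1 n).map (addRightEmbedding 1) := by
    rw [Finset.map_add_right_Ico]
    rfl
  rw [h2, Finset.sum_map]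
  rcases Nat.eq_zero_or_pos n with rfl | hn
  · rfl
  rw [Finset.sum_eq_sum_Ico_succ_bot hn]
  simp [h1]

/-- The Murphy operators and the encircled identity braid. -/
theorem cls_encircled (z : Kˣ) (hz : (z : K) = (s : K) - ↑s⁻¹) {n : ℕ} (hn : 1 ≤ n) :
    cls v s (encircled n) = ((z : K) ^ 2 * ↑v⁻¹) • murphySum v s n +
      ((n : K) * z * ↑v⁻¹ + (↑v⁻¹ - ↑v) * ↑z⁻¹) • (1 : Skein v s n) := by
  have h := congrFun (sem_loop (v := v) z hz hn) ⟨n, [], [], [], [], by simp, by simp⟩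
  rw [← slices_encircled, ← cls_eq_of_sem] at h
  rw [h, murphySum_eq, Pi.add_apply, Pi.smul_apply, Pi.smul_apply, Finset.sum_apply]
  congr 2
  · refine Finset.sum_congr rfl fun m hm => ?_
    rw [Finset.sum_apply]
    refine Finset.sum_congr rfl fun l hl => ?_
    rw [Finset.mem_range] at hm hl
    have e : m + 1 = m - l + l + 1 := by omega
    rw [e, cls_eq_of_sem, slices_omega (by omega) (by omega)]
  · have h1 : (1 : Skein v s n) = cls v s 1 := by rw [cls, map_one, map_one]
    rw [h1, cls_eq_of_sem]
    rfl

theorem cls_mul {n : ℕ} (D E : NTangle n) : cls v s (D * E) = cls v s D * cls v s E := by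
  simp [cls, MonoidAlgebra.single_mul_single, ← map_mul]

theorem cls_encircled_mem_center (n : ℕ) :
    cls v s (encircled n) ∈ Subalgebra.center K (Skein v s n) := by
  rw [Subalgebra.mem_center_iff]
  intro x
  obtain ⟨x, rfl⟩ := RingQuot.mkAlgHom_surjective K (SkeinRel v s n) x
  -- The skein is spanned by diagrams, so commuting with each diagram is enough.
  induction x using MonoidAlgebra.induction_on with
  | of D =>
    change cls v s D * _ = _ * cls v s D
    have h := loop_comm (v := v) (s := s) D.isDiagram
    rw [← slices_encircled] at h
    rw [← cls_mul, ← cls_mul, cls_eq_of_sem, cls_eq_of_sem]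
    exact congrFun h.symm _
  | add x y hx hy => rw [map_add, add_mul, mul_add, hx, hy]
  | smul r x hx => rw [map_smul, smul_mul_assoc, mul_smul_comm, hx]

end Encircled
end Homfly

theorem mainTheorem5 {K : Type*} [CommRing K] (v s z : Kˣ) (hz : (z : K) = (s : K) - ↑s⁻¹)
    (n : ℕ) (hn : 1 ≤ n) :
    Homfly.cls v s (Homfly.encircled n) =
        ((z : K) ^ 2 * ↑v⁻¹) • Homfly.murphySum v s n +
          ((n : K) * z * ↑v⁻¹ + (↑v⁻¹ - ↑v) * ↑z⁻¹) • (1 : Homfly.Skein v s n) ∧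
      Homfly.murphySum v s n =
        ((v : K) * ↑z⁻¹ ^ 2) • (Homfly.cls v s (Homfly.encircled n) -
          ((n : K) * z * ↑v⁻¹ + (↑v⁻¹ - ↑v) * ↑z⁻¹) • (1 : Homfly.Skein v s n)) ∧
      Homfly.cls v s (Homfly.encircled n) ∈ Subalgebra.center K (Homfly.Skein v s n) ∧
      Homfly.murphySum v s n ∈ Subalgebra.center K (Homfly.Skein v s n) := by
  have h := Homfly.cls_encircled (v := v) z hz hn
  have hu : (v : K) * (↑z⁻¹ : K) ^ 2 * ((z : K) ^ 2 * ↑v⁻¹) = 1 := by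
    calc (v : K) * (↑z⁻¹ : K) ^ 2 * ((z : K) ^ 2 * ↑v⁻¹)
        = (v * ↑v⁻¹) * (z * ↑z⁻¹) ^ 2 := by ring
      _ = 1 := by simp
  have hM : Homfly.murphySum v s n =
      ((v : K) * ↑z⁻¹ ^ 2) • (Homfly.cls v s (Homfly.encircled n) -
        ((n : K) * z * ↑v⁻¹ + (↑v⁻¹ - ↑v) * ↑z⁻¹) • (1 : Homfly.Skein v s n)) := by
    rw [h, add_sub_cancel_right, smul_smul, hu, one_smul]
  have hT := Homfly.cls_encircled_mem_center (v := v) (s := s) n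
  refine ⟨h, hM, hT, ?_⟩
  rw [hM]
  exact Subalgebra.smul_mem _ (Subalgebra.sub_mem _ hT
    (Subalgebra.smul_mem _ (Subalgebra.one_mem _) _)) _
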